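/- Let $M^n$ be a connected smooth Riemannian manifold and $f\colon M^n\to\mathbb R^N$ a smooth isometric immersion that is locally substantial, i.e. no nonempty open subset of $M$ is mapped by $f$ into a proper affine subspace of $\mathbb R^N$. Let $\alpha_f$ be its second fundamental form and $N_1(x)=\mathrm{span}\{\alpha_f(X,Y): X,Y\in T_xM\}$ its first normal space at $x$. Assume that $\dim N_1(x)=p$ for all $x\in M$, with $p<N-n$. Let $N_1^\perp$ be the orthogonal complement of $N_1$ in the normal bundle, and let $$\mathcal S(x)=\mathrm{span}\{(\nabla^\perp_X\mu)_{N_1}: X\in T_xM,\ \mu \text{ a smooth local section of } N_1^\perp \text{ near } x\}\subset N_1(x).$$ Assume that $\dim\mathcal S(x)=s$ for all $x\in M$, where $0<s<n$ and $s\le 6$. For $x\in M$ put $\mathcal N(\alpha_f)(x)=\{Y\in T_xM:\alpha_f(Y,X)=0\ \forall X\in T_xM\}$ (the relative nullity subspace), $\nu_f(x)=\dim\mathcal N(\alpha_f)(x)$, and $D(x)=\mathcal N(\alpha_{\mathcal S})(x)=\{Y\in T_xM:\pi_{\mathcal S(x)}\alpha_f(Y,X)=0\ \forall X\in T_xM\}$,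 where $\pi_{\mathcal S(x)}$ is the orthogonal projection onto $\mathcal S(x)$. Consider the following situations. - Case (i): $s=p$ and $\nu_f\ge n-p$ everywhere on $M$. - Case (iii)(a) on an open set $U\subset M$: $1<s<p$; for some $d\ge n-s$, $D|_U$ is a $d$-dimensional integrable distribution each of whose leaves in $U$ is mapped by $f$ onto an open subset of a $d$-dimensional affine subspace of $\mathbb R^N$; and $\mathcal S$ is constant in $\mathbb R^N$ along the leaves of $D$ in $U$. Then: 1. If $\mathrm{Ric}_M>0$, then $s<p$ (so that case (i) does not occur), and case (iii)(a) does not occur on any nonempty open set $U\subset M$. 2. If $\mathrm{Ric}_M\ge 0$ and case (iii)(a) occurs on an open set $U\subset M$, then $D(x)=\mathcal N(\alpha_f)(x)$ for every $x\in U$, i.e. the ruling foliation $D$ is the relative nullity foliation on $U$. -/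

import Mathlib

open Set Topology Manifold
open scoped ContDiff

noncomputable section

/-- The Euclidean space `ℝᵏ` with its standard inner product. -/
abbrev Euc (k : ℕ) : Type := EuclideanSpace ℝ (Fin k)

/-- A smooth Riemannian metric on an `n`-dimensional manifold. -/
abbrev RiemMetric (n : ℕ) (M : Type*) [TopologicalSpace M] [ChartedSpace (Euc n) M]
    [IsManifold (𝓡 n) ∞ M] : Type _ :=
  Bundle.ContMDiffRiemannianMetric (𝓡 n) ∞ (Euc n)
    (fun x : M => TangentSpace (𝓡 n) x)

section Intrinsic

variable {n : ℕ} {M : Type*} [TopologicalSpace M] [ChartedSpace (Euc n) M]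

/-- The coordinates of the tangent vector `v` at `x` in the preferred chart at `x`. -/
def chartVec (x : M) : TangentSpace (𝓡 n) x →L[ℝ] Euc n :=
  mfderiv (𝓡 n) 𝓘(ℝ, Euc n) (extChartAt (𝓡 n) x) x

/-- The `i`-th partial derivative of a function on `ℝⁿ`. -/
def partialDeriv (i : Fin n) (h : Euc n → ℝ) (y : Euc n) : ℝ :=
  fderiv ℝ h y (EuclideanSpace.single i 1)

variable [IsManifold (𝓡 n) ∞ M]

/-- The matrix `(g_ij)` of the metric in the preferred chart at `x`, at the point of the manifold
with coordinates `y`. -/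
def metricCoeff (g : RiemMetric n M) (x : M) (y : Euc n) : Matrix (Fin n) (Fin n) ℝ :=
  Matrix.of fun i j =>
    g.inner ((extChartAt (𝓡 n) x).symm y)
      (mfderiv 𝓘(ℝ, Euc n) (𝓡 n) (extChartAt (𝓡 n) x).symm y (EuclideanSpace.single i 1))
      (mfderiv 𝓘(ℝ, Euc n) (𝓡 n) (extChartAt (𝓡 n) x).symm y (EuclideanSpace.single j 1))

/-- The Christoffel symbol `Γᵏ_ij` of the Levi-Civita connection in the preferred chart at `x`. -/
def christoffel (g : RiemMetric n M) (x : M) (k i j : Fin n) (y : Euc n) : ℝ :=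
  (1 / 2 : ℝ) * ∑ l, (metricCoeff g x y)⁻¹ k l *
    (partialDeriv i (fun z => metricCoeff g x z j l) y
      + partialDeriv j (fun z => metricCoeff g x z i l) y
      - partialDeriv l (fun z => metricCoeff g x z i j) y)

/-- The components `Ric_jk` of the Ricci tensor in the preferred chart at `x`, with the sign for
which round spheres have positive Ricci curvature. -/
def ricciCoeff (g : RiemMetric n M) (x : M) (j k : Fin n) (y : Euc n) : ℝ :=
  ∑ i, (partialDeriv i (christoffel g x i j k) y - partialDeriv j (christoffel g x i i k) y
    + ∑ m, (christoffel g x i i m y * christoffel g x m j k y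
      - christoffel g x i j m y * christoffel g x m i k y))

/-- The Ricci curvature `Ric(v, v)` of a tangent vector `v` at `x`. -/
def ricci (g : RiemMetric n M) (x : M) (v : TangentSpace (𝓡 n) x) : ℝ :=
  ∑ j, ∑ k, ricciCoeff g x j k (extChartAt (𝓡 n) x x) * chartVec x v j * chartVec x v k

/-- `Ric_M > 0`. -/
def RicciPos (g : RiemMetric n M) : Prop :=
  ∀ (x : M) (v : TangentSpace (𝓡 n) x), v ≠ 0 → 0 < ricci g x v

/-- `Ric_M ≥ 0`. -/
def RicciNonneg (g : RiemMetric n M) : Prop :=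
  ∀ (x : M) (v : TangentSpace (𝓡 n) x), 0 ≤ ricci g x v

end Intrinsic

section Extrinsic

variable {n N : ℕ} {M : Type*} [TopologicalSpace M] [ChartedSpace (Euc n) M]

/-- The differential `f_* : T_xM → ℝᴺ`. -/
def diff (f : M → Euc N) (x : M) : TangentSpace (𝓡 n) x →L[ℝ] Euc N :=
  mfderiv (𝓡 n) 𝓘(ℝ, Euc N) f x

/-- `f : (M, g) → ℝᴺ` is a smooth isometric immersion. (The differential is injective because `g` is
positive definite.) -/
def IsIsometricImmersion [IsManifold (𝓡 n) ∞ M] (g : RiemMetric n M) (f : M → Euc N) : Prop :=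
  ContMDiff (𝓡 n) 𝓘(ℝ, Euc N) ∞ f ∧
    ∀ (x : M) (v w : TangentSpace (𝓡 n) x), g.inner x v w = inner ℝ (diff f x v) (diff f x w)

/-- No nonempty open subset of `M` is mapped by `f` into a proper affine subspace. -/
def LocallySubstantial (f : M → Euc N) : Prop :=
  ∀ U : Set M, IsOpen U → U.Nonempty →
    ∀ A : AffineSubspace ℝ (Euc N), f '' U ⊆ (A : Set (Euc N)) → A = ⊤

variable (n) in
/-- The normal space of `f` at `x`. -/
def normalSpace (f : M → Euc N) (x : M) : Submodule ℝ (Euc N) :=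
  (LinearMap.range (diff (n := n) f x).toLinearMap)ᗮ

/-- The second fundamental form `α_f(v, w)` at `x`: the normal component of the second derivative
of `f`, written in the preferred chart at `x`. -/
def secondFF (f : M → Euc N) (x : M) :
    TangentSpace (𝓡 n) x →ₗ[ℝ] TangentSpace (𝓡 n) x →ₗ[ℝ] Euc N :=
  LinearMap.mk₂ ℝ
    (fun v w => (normalSpace n f x).starProjection
      (fderiv ℝ (fderiv ℝ (f ∘ (extChartAt (𝓡 n) x).symm)) (extChartAt (𝓡 n) x x)
        (chartVec x v) (chartVec x w)))
    (by intros; simp) (by intros; simp) (by intros; simp) (by intros; simp)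

variable (n) in
/-- The first normal space `N₁(x)`, the span of the second fundamental form. -/
def firstNormal (f : M → Euc N) (x : M) : Submodule ℝ (Euc N) :=
  Submodule.span ℝ {ξ | ∃ v w : TangentSpace (𝓡 n) x, ξ = secondFF f x v w}

/-- The relative nullity subspace `{Y : α_f(Y, X) = 0 for all X}` at `x`. -/
def relNullity (f : M → Euc N) (x : M) : Submodule ℝ (TangentSpace (𝓡 n) x) :=
  ⨅ X : TangentSpace (𝓡 n) x, LinearMap.ker ((secondFF f x).flip X)

/-- The nullity `{Y : π_W α_f(Y, X) = 0 for all X}` at `x` of the component of the second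
fundamental form in the subspace `W`. -/
def nullity (f : M → Euc N) (x : M) (W : Submodule ℝ (Euc N)) :
    Submodule ℝ (TangentSpace (𝓡 n) x) :=
  ⨅ X : TangentSpace (𝓡 n) x,
    LinearMap.ker (W.starProjection.toLinearMap ∘ₗ (secondFF f x).flip X)

variable (n) in
/-- The orthogonal complement `N₁^⊥(x)` of the first normal space in the normal space. -/
def firstNormalPerp (f : M → Euc N) (x : M) : Submodule ℝ (Euc N) :=
  normalSpace n f x ⊓ (firstNormal n f x)ᗮ

variable (n) in
/-- `μ` is a smooth section of `N₁^⊥` over the set `O`. -/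
def IsSectionPerp (f : M → Euc N) (O : Set M) (μ : M → Euc N) : Prop :=
  ContMDiffOn (𝓡 n) 𝓘(ℝ, Euc N) ∞ μ O ∧ ∀ y ∈ O, μ y ∈ firstNormalPerp n f y

/-- The normal derivative `∇^⊥_X μ` at `x`. -/
def normalDeriv (f : M → Euc N) (μ : M → Euc N) (x : M) (X : TangentSpace (𝓡 n) x) : Euc N :=
  (normalSpace n f x).starProjection (diff μ x X)

variable (n) in
/-- The space `𝒮(x)` spanned by the components `(∇^⊥_X μ)_{N₁}`, for `X ∈ T_xM` and `μ` a
local section of `N₁^⊥` near `x`. -/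
def spaceS (f : M → Euc N) (x : M) : Submodule ℝ (Euc N) :=
  Submodule.span ℝ {ζ | ∃ (O : Set M) (μ : M → Euc N) (X : TangentSpace (𝓡 n) x),
    IsOpen O ∧ x ∈ O ∧ IsSectionPerp n f O μ ∧
      ζ = (firstNormal n f x).starProjection (normalDeriv f μ x X)}

/-- The distribution `𝒩(α_𝒮)`. -/
def distD (f : M → Euc N) (x : M) : Submodule ℝ (TangentSpace (𝓡 n) x) :=
  nullity f x (spaceS n f x)

end Extrinsic

section Foliations

variable {n N : ℕ} {M : Type*} [TopologicalSpace M] [ChartedSpace (Euc n) M]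

/-- The leaf through `x` of the (integrable) distribution `D` on the open set `U`: the points that
can be joined to `x` by a smooth curve in `U` tangent to `D`. -/
def leaf (U : Set M) (D : ∀ x : M, Submodule ℝ (TangentSpace (𝓡 n) x)) (x : M) : Set M :=
  {y | ∃ γ : ℝ → M, ContMDiff 𝓘(ℝ, ℝ) (𝓡 n) ∞ γ ∧ γ 0 = x ∧ γ 1 = y ∧
    ∀ t : ℝ, γ t ∈ U ∧
      LinearMap.range (mfderiv 𝓘(ℝ, ℝ) (𝓡 n) γ t).toLinearMap ≤ D (γ t)}

/-- Through each point of `U` there is a `d`-dimensional integral manifold of `D` in `U`, given by a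
smooth local parametrization. -/
def IsIntegrable (U : Set M) (D : ∀ x : M, Submodule ℝ (TangentSpace (𝓡 n) x))
    (d : ℕ) : Prop :=
  ∀ x ∈ U, ∃ (W : Set (Euc d)) (σ : Euc d → M), IsOpen W ∧ (0 : Euc d) ∈ W ∧
    ContMDiffOn 𝓘(ℝ, Euc d) (𝓡 n) ∞ σ W ∧ σ 0 = x ∧
    ∀ w ∈ W, σ w ∈ U ∧
      LinearMap.range (mfderiv 𝓘(ℝ, Euc d) (𝓡 n) σ w).toLinearMap = D (σ w)

variable [IsManifold (𝓡 n) ∞ M]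

/-- `D` is a smooth `d`-dimensional distribution on `U`: it has rank `d`, and each of its vectors
extends locally to a smooth vector field in `D`. -/
def IsSmoothDistribution (U : Set M) (D : ∀ x : M, Submodule ℝ (TangentSpace (𝓡 n) x))
    (d : ℕ) : Prop :=
  ∀ x ∈ U, Module.finrank ℝ (D x) = d ∧
    ∀ v ∈ D x, ∃ (O : Set M) (X : ∀ y : M, TangentSpace (𝓡 n) y),
      IsOpen O ∧ x ∈ O ∧ O ⊆ U ∧ X x = v ∧ (∀ y ∈ O, X y ∈ D y) ∧
        ContMDiffOn (𝓡 n) (𝓡 n).tangent ∞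
          (fun y => (⟨y, X y⟩ : TangentBundle (𝓡 n) M)) O

/-- `f` restricted to `U` is `D`-ruled, with rulings of dimension `d`: `D` is a `d`-dimensional
integrable distribution on `U` and `f` maps each leaf onto an open subset of a `d`-dimensional affine
subspace. -/
def IsRuled (f : M → Euc N) (U : Set M) (D : ∀ x : M, Submodule ℝ (TangentSpace (𝓡 n) x))
    (d : ℕ) : Prop :=
  IsSmoothDistribution U D d ∧ IsIntegrable U D d ∧
    ∀ x ∈ U, ∃ (A : AffineSubspace ℝ (Euc N)) (O : Set (Euc N)),
      Module.finrank ℝ A.direction = d ∧ IsOpen O ∧ f '' leaf U D x = O ∩ (A : Set (Euc N))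

variable (n) in
/-- Case (i): `s = p` and the index of relative nullity is everywhere at least `n - p`. -/
def CaseI (f : M → Euc N) (p s : ℕ) : Prop :=
  s = p ∧ ∀ x : M, n ≤ Module.finrank ℝ (relNullity (n := n) f x) + p

variable (n) in
/-- Case (iii)(a) on the open set `U`: `1 < s < p`, `f` restricted to `U` is ruled by
`D = 𝒩(α_𝒮)` with rulings of dimension at least `n - s`, and `𝒮` is constant in `ℝᴺ` along the
leaves of `D`. -/
def CaseIIIa (f : M → Euc N) (p s : ℕ) (U : Set M) : Prop :=
  1 < s ∧ s < p ∧ (∃ d : ℕ, n ≤ d + s ∧ IsRuled f U (distD (n := n) f) d) ∧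
    ∀ x ∈ U, ∀ y ∈ leaf U (distD (n := n) f) x, spaceS n f y = spaceS n f x

end Foliations

end

/-! Everything rests on one consequence of the Gauss equation. In an orthonormal frame, `Ric(v,v) =
⟪α(v,v), tr α⟫ - ∑ ‖α(e_i,v)‖²`. If `α(v,v) = 0`, then `Ric(v,v) ≤ 0`, and equality forces `α(·,v) =
0`, that is, `v` lies in the relative nullity (`IsIsometricImmersion.ricci_nonpos`). It remains to
produce isotropic vectors of `α`.

In a ruled situation every direction of `D` is isotropic: second derivatives of `f` along a leaf
stay in the direction of the affine subspace, which equals `f_* D` by dimension and is therefore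
tangent (`IsRuled.secondFF_eq_zero`). Since `d ≥ n - s > 0`, positive Ricci curvature is impossible,
while nonnegative Ricci curvature puts `D` inside the relative nullity; the other inclusion is
immediate.

If `s = p`, then `𝒮 = N₁`, so `α` takes values in `𝒮`. A section `μ` of `N₁^⊥` has zero shape
operator, so Codazzi makes `⟪α(X,Y), φ_μ Z⟫` symmetric in `X` and `Z`, where `φ_μ X = (∇^⊥_X
μ)_{N₁}`. Take `φ` of maximal rank among these maps. As `s < n`, some `X ≠ 0` has `φ X = 0`, and
maximality gives `ψ X ∈ range φ` for every other `ψ`. Two uses of the symmetry then show `α(X,X) ⊥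
𝒮`, hence `α(X,X) = 0` (`exists_isotropic`). -/

noncomputable section

/-! ### Regular elements and isotropic vectors of symmetric bilinear maps. -/

section LinearAlgebra

variable {V W : Type*} [AddCommGroup V] [Module ℝ V] [FiniteDimensional ℝ V]

/-- A linear map of maximal rank in a space of linear maps is a regular element: every other map of
the space sends its kernel into its range. -/
theorem exists_regular [NormedAddCommGroup W] [NormedSpace ℝ W]
    (Φ : Submodule ℝ (V →ₗ[ℝ] W)) :
    ∃ φ ∈ Φ, ∀ ψ ∈ Φ, ∀ X, φ X = 0 → ψ X ∈ LinearMap.range φ := by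
  let S : Set ℕ := {r | ∃ φ ∈ Φ, Module.finrank ℝ (LinearMap.range φ) = r}
  have hS : S.Nonempty := ⟨_, 0, Φ.zero_mem, rfl⟩
  have hb : BddAbove S := ⟨Module.finrank ℝ V, by
    rintro r ⟨φ, -, rfl⟩
    exact LinearMap.finrank_range_le φ⟩
  obtain ⟨φ, hφ, hr⟩ := Nat.sSup_mem hS hb
  have hmax : ∀ ψ ∈ Φ, Module.finrank ℝ (LinearMap.range ψ) ≤
      Module.finrank ℝ (LinearMap.range φ) := fun ψ hψ => hr ▸ le_csSup hb ⟨ψ, hψ, rfl⟩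
  refine ⟨φ, hφ, fun ψ hψ X hX => ?_⟩
  by_contra hcon
  let b := Module.finBasis ℝ (LinearMap.range φ)
  have hpre : ∀ i, ∃ Y, φ Y = b i := fun i => (b i).2
  choose Y hY using hpre
  -- If `ψ X` is outside the range of `φ`, adjoining it to a basis of that range gives an
  -- independent family at `t = 0`. Independence is an open condition, so it survives for small `t ≠
  -- 0`.
  let v : ℝ → Option (Fin (Module.finrank ℝ (LinearMap.range φ))) → W := fun t o =>
    o.elim (ψ X) (fun i => φ (Y i) + t • ψ (Y i))
  have hv0 : LinearIndependent ℝ (v 0) := by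
    rw [linearIndependent_option]
    have h1 : v 0 ∘ some = fun i => (b i : W) := by
      funext i; simp [v, hY]
    constructor
    · change LinearIndependent ℝ (v 0 ∘ some)
      rw [h1]
      exact b.linearIndependent.map' (LinearMap.range φ).subtype (Submodule.ker_subtype _)
    · intro hmem
      apply hcon
      have : Submodule.span ℝ (Set.range (v 0 ∘ some)) ≤ LinearMap.range φ := by
        rw [h1, Submodule.span_le]
        rintro _ ⟨i, rfl⟩
        exact (b i).2
      exact this hmem
  have hvc : Continuous v := by
    refine continuous_pi fun o => ?_
    cases o with
    | none => exact continuous_const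
    | some i => exact continuous_const.add (continuous_id.smul continuous_const)
  have hev : ∀ᶠ t in 𝓝 (0 : ℝ), LinearIndependent ℝ (v t) :=
    hvc.continuousAt.eventually hv0.eventually
  obtain ⟨t, ht, ht0⟩ :=
    ((hev.filter_mono nhdsWithin_le_nhds).and (self_mem_nhdsWithin : {0}ᶜ ∈ 𝓝[≠] (0 : ℝ))).exists
  have ht0 : t ≠ 0 := ht0
  -- Since `φ X = 0`, the extra vector is `ψ X = (φ + t • ψ) (t⁻¹ • X)`; thus `φ + t • ψ` has larger
  -- rank than `φ`.
  have hmem : ∀ o, v t o ∈ LinearMap.range (φ + t • ψ) := by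
    intro o
    cases o with
    | none => exact ⟨t⁻¹ • X, by simp [hX, v, ht0]⟩
    | some i => exact ⟨Y i, by simp [v]⟩
  have hli : LinearIndependent ℝ (fun o => (⟨v t o, hmem o⟩ : LinearMap.range (φ + t • ψ))) :=
    LinearIndependent.of_comp (LinearMap.range (φ + t • ψ)).subtype ht
  have h1 := hli.fintype_card_le_finrank
  have h2 := hmax _ (Φ.add_mem hφ (Φ.smul_mem t hψ))
  simp at h1
  omega

/-- If `α` takes values in the span of the values of a linear space `Φ` of maps, the trilinear forms
`⟪α X Y, φ Z⟫` with `φ ∈ Φ` are symmetric, and that span is of small dimension, then `α` has a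
nonzero isotropic vector. -/
theorem exists_isotropic [NormedAddCommGroup W] [InnerProductSpace ℝ W]
    (Φ : Submodule ℝ (V →ₗ[ℝ] W)) (α : V → V → W) (hα : ∀ X Y, α X Y = α Y X)
    (hC : ∀ φ ∈ Φ, ∀ X Y Z, inner ℝ (α X Y) (φ Z) = inner ℝ (α Z Y) (φ X))
    (S : Submodule ℝ W) [FiniteDimensional ℝ S]
    (hS : S = Submodule.span ℝ {w | ∃ φ ∈ Φ, ∃ X, w = φ X})
    (hαS : ∀ X Y, α X Y ∈ S) (hdim : Module.finrank ℝ S < Module.finrank ℝ V) :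
    ∃ X, X ≠ 0 ∧ α X X = 0 := by
  obtain ⟨φ, hφ, hreg⟩ := exists_regular Φ
  have hφS : LinearMap.range φ ≤ S := by
    rintro _ ⟨X, rfl⟩
    rw [hS]
    exact Submodule.subset_span ⟨φ, hφ, X, rfl⟩
  have hker : LinearMap.ker φ ≠ ⊥ := by
    intro h
    have h1 := φ.finrank_range_add_finrank_ker
    have h2 := Submodule.finrank_mono hφS
    rw [h, finrank_bot] at h1
    omega
  obtain ⟨X, hX, hX0⟩ := Submodule.exists_mem_ne_zero_of_ne_bot hker
  have hX : φ X = 0 := hX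
  refine ⟨X, hX0, ?_⟩
  -- With `ψ X = φ U`: `⟪α X X, ψ Z⟫ = ⟪α Z X, φ U⟫ = ⟪α U Z, φ X⟫ = 0`.
  have horth : ∀ w ∈ S, inner ℝ (α X X) w = 0 := by
    intro w hw
    rw [hS] at hw
    induction hw using Submodule.span_induction with
    | mem w hw =>
      obtain ⟨ψ, hψ, Z, rfl⟩ := hw
      obtain ⟨U, hU⟩ := hreg ψ hψ X hX
      rw [hC ψ hψ, ← hU, hα Z X, hC φ hφ, hX, inner_zero_right]
    | zero => simp
    | add a b _ _ ha hb => rw [inner_add_right, ha, hb, add_zero]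
    | smul c a _ ha => rw [inner_smul_right, ha, mul_zero]
  exact inner_self_eq_zero.1 (horth _ (hαS X X))

end LinearAlgebra

/-! ### Second derivatives of maps between normed spaces. -/

section EuclideanCalculus

/-- The second derivative of a composition. -/
theorem fderiv_fderiv_comp {A B C : Type*} [NormedAddCommGroup A] [NormedSpace ℝ A]
    [NormedAddCommGroup B] [NormedSpace ℝ B] [NormedAddCommGroup C] [NormedSpace ℝ C]
    {F : B → C} {τ : A → B} {a : A} (hF : ContDiffAt ℝ 2 F (τ a)) (hτ : ContDiffAt ℝ 2 τ a)
    (u v : A) :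
    fderiv ℝ (fderiv ℝ (F ∘ τ)) a u v =
      fderiv ℝ (fderiv ℝ F) (τ a) (fderiv ℝ τ a u) (fderiv ℝ τ a v)
        + fderiv ℝ F (τ a) (fderiv ℝ (fderiv ℝ τ) a u v) := by
  have hev : fderiv ℝ (F ∘ τ) =ᶠ[𝓝 a] fun z => (fderiv ℝ F (τ z)).comp (fderiv ℝ τ z) := by
    filter_upwards [hτ.eventually (by simp),
      hτ.continuousAt.eventually (hF.eventually (by simp))] with z h1 h2
    exact fderiv_comp z (h2.differentiableAt (by simp)) (h1.differentiableAt (by simp))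
  have hF' : DifferentiableAt ℝ (fderiv ℝ F) (τ a) :=
    (hF.fderiv_right (m := 1) (by norm_num)).differentiableAt (by simp)
  have hτ' : DifferentiableAt ℝ (fderiv ℝ τ) a :=
    (hτ.fderiv_right (m := 1) (by norm_num)).differentiableAt (by simp)
  have hτ0 : DifferentiableAt ℝ τ a := hτ.differentiableAt (by simp)
  have h := (hF'.hasFDerivAt.comp a hτ0.hasFDerivAt).clm_comp hτ'.hasFDerivAt
  have h' : fderiv ℝ (fun z => (fderiv ℝ F (τ z)).comp (fderiv ℝ τ z)) a = _ := h.fderiv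
  rw [hev.fderiv_eq, h']
  simp [add_comm]

theorem ContDiffAt.snd_fderiv_comm {A C : Type*} [NormedAddCommGroup A] [NormedSpace ℝ A]
    [NormedAddCommGroup C] [NormedSpace ℝ C] {F : A → C} {a : A} {k : ℕ∞ω}
    (hF : ContDiffAt ℝ k F a) (hk : 2 ≤ k) (u v : A) :
    fderiv ℝ (fderiv ℝ F) a u v = fderiv ℝ (fderiv ℝ F) a v u :=
  (hF.isSymmSndFDerivAt (by simpa using hk)).eq u v

/-- If `m` is normal to the first two derivatives of `F`, its derivative is normal to the first one. -/
theorem inner_fderiv_eq_zero {A C : Type*} [NormedAddCommGroup A] [NormedSpace ℝ A]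
    [NormedAddCommGroup C] [InnerProductSpace ℝ C] {F m : A → C} {a : A}
    (hF : ContDiffAt ℝ 2 F a) (hm : DifferentiableAt ℝ m a) (u v : A)
    (h : ∀ᶠ z in 𝓝 a, inner ℝ (m z) (fderiv ℝ F z v) = 0)
    (h2 : inner ℝ (m a) (fderiv ℝ (fderiv ℝ F) a u v) = 0) :
    inner ℝ (fderiv ℝ m a u) (fderiv ℝ F a v) = 0 := by
  have hF1 : DifferentiableAt ℝ (fderiv ℝ F) a :=
    (hF.fderiv_right (m := 1) (by norm_num)).differentiableAt (by simp)
  have h0 : (fun z => inner ℝ (m z) (fderiv ℝ F z v)) =ᶠ[𝓝 a] fun _ => (0 : ℝ) := h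
  have h3 := (hm.hasFDerivAt.inner ℝ (hF1.hasFDerivAt.clm_apply (hasFDerivAt_const v a))).fderiv
  rw [h0.fderiv_eq] at h3
  have h4 := congrArg (fun T => T u) h3
  simp [fderivInnerCLM_apply, h2] at h4
  exact h4.symm

/-- The Codazzi equation for a field normal to the first two derivatives of `F`. -/
theorem inner_snd_fderiv_comm {A C : Type*} [NormedAddCommGroup A] [NormedSpace ℝ A]
    [NormedAddCommGroup C] [InnerProductSpace ℝ C] {F m : A → C} {a : A}
    (hF : ContDiffAt ℝ 3 F a) (hm : DifferentiableAt ℝ m a)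
    (h : ∀ᶠ z in 𝓝 a, ∀ u v, inner ℝ (m z) (fderiv ℝ (fderiv ℝ F) z u v) = 0) (u v w : A) :
    inner ℝ (fderiv ℝ (fderiv ℝ F) a u v) (fderiv ℝ m a w) =
      inner ℝ (fderiv ℝ (fderiv ℝ F) a w v) (fderiv ℝ m a u) := by
  have hF1 : ContDiffAt ℝ 2 (fderiv ℝ F) a := hF.fderiv_right (by norm_num)
  have hF2 : DifferentiableAt ℝ (fderiv ℝ (fderiv ℝ F)) a :=
    (hF1.fderiv_right (m := 1) (by norm_num)).differentiableAt (by simp)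
  -- Differentiating `⟪m, F_uv⟫ = 0` moves the derivative onto `F`; the symmetry in `u` and `w` is
  -- then that of the third derivative.
  have key : ∀ u v w, inner ℝ (fderiv ℝ (fderiv ℝ F) a u v) (fderiv ℝ m a w) =
      - inner ℝ (m a) (fderiv ℝ (fderiv ℝ (fderiv ℝ F)) a w u v) := by
    intro u v w
    have h0 : (fun z => inner ℝ (m z) (fderiv ℝ (fderiv ℝ F) z u v)) =ᶠ[𝓝 a] fun _ => (0 : ℝ) := by
      filter_upwards [h] with z hz using hz u v
    have h1 := hm.hasFDerivAt.inner ℝ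
      ((hF2.hasFDerivAt.clm_apply (hasFDerivAt_const u a)).clm_apply (hasFDerivAt_const v a))
    have h2 := h1.fderiv
    rw [h0.fderiv_eq] at h2
    have h3 := congrArg (fun T => T w) h2
    simp [fderivInnerCLM_apply] at h3
    rw [real_inner_comm]
    linarith
  rw [key, key, hF1.snd_fderiv_comm le_rfl]

end EuclideanCalculus

/-! ### Differentiability of the inverse matrix. -/

section InverseMatrix

variable {E : Type*} [NormedAddCommGroup E] [NormedSpace ℝ E] {n : ℕ}

theorem differentiableAt_det {A : E → Matrix (Fin n) (Fin n) ℝ} {y : E}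
    (hA : ∀ i j, DifferentiableAt ℝ (fun z => A z i j) y) :
    DifferentiableAt ℝ (fun z => (A z).det) y := by
  simp only [Matrix.det_apply]
  refine DifferentiableAt.fun_sum fun σ _ => DifferentiableAt.const_smul ?_ _
  exact (HasFDerivAt.finsetProd fun i _ => (hA (σ i) i).hasFDerivAt).differentiableAt

theorem differentiableAt_matrix_inv {A : E → Matrix (Fin n) (Fin n) ℝ} {y : E}
    (hA : ∀ i j, DifferentiableAt ℝ (fun z => A z i j) y) (hdet : (A y).det ≠ 0) (i j : Fin n) :
    DifferentiableAt ℝ (fun z => (A z)⁻¹ i j) y := by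
  simp only [Matrix.inv_def, Matrix.smul_apply, Ring.inverse_eq_inv', Matrix.adjugate_apply,
    smul_eq_mul]
  refine ((differentiableAt_det hA).inv hdet).mul (differentiableAt_det fun a b => ?_)
  -- By Cramer's rule the cofactor is the determinant of `A` with row `j` replaced by a constant
  -- vector.
  by_cases h : a = j
  · subst h
    simp
  · simpa [Matrix.updateRow_ne h] using hA a b

end InverseMatrix

/-! ### The contracted Gauss equation in a chart. -/

section Gauss

variable {n N : ℕ} {M : Type*} [TopologicalSpace M] [ChartedSpace (Euc n) M]
  [IsManifold (𝓡 n) ∞ M]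

/-- The coordinate vector fields of the immersion `F`. -/
abbrev coordVec (F : Euc n → Euc N) (y : Euc n) (i : Fin n) : Euc N :=
  fderiv ℝ F y (EuclideanSpace.single i 1)

/-- The second partial derivatives of `F`. -/
abbrev sndPartial (F : Euc n → Euc N) (y : Euc n) (i j : Fin n) : Euc N :=
  fderiv ℝ (fderiv ℝ F) y (EuclideanSpace.single i 1) (EuclideanSpace.single j 1)

/-- In the chart at `x`, the metric `g` is over `Ω` the one induced by the immersion `F`. -/
structure IsInducedOn (g : RiemMetric n M) (x : M) (F : Euc n → Euc N) (Ω : Set (Euc n)) :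
    Prop where
  isOpen : IsOpen Ω
  contDiffAt : ∀ y ∈ Ω, ContDiffAt ℝ ∞ F y
  injective : ∀ y ∈ Ω, Function.Injective (fderiv ℝ F y)
  metricCoeff_eq : ∀ y ∈ Ω, ∀ i j,
    metricCoeff g x y i j = inner ℝ (coordVec F y i) (coordVec F y j)

namespace IsInducedOn

variable {g : RiemMetric n M} {x : M} {F : Euc n → Euc N} {Ω : Set (Euc n)} {y : Euc n}

theorem linearIndependent (h : IsInducedOn g x F Ω) (hy : y ∈ Ω) :
    LinearIndependent ℝ (coordVec F y) := by
  have h1 : LinearIndependent ℝ (fun i : Fin n => (EuclideanSpace.single i 1 : Euc n)) := by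
    have h2 : (fun i : Fin n => (EuclideanSpace.single i 1 : Euc n)) =
        (EuclideanSpace.basisFun (Fin n) ℝ).toBasis := by
      funext i
      simp
    rw [h2]
    exact (EuclideanSpace.basisFun (Fin n) ℝ).toBasis.linearIndependent
  exact h1.map' (fderiv ℝ F y).toLinearMap (LinearMap.ker_eq_bot.2 (h.injective y hy))

theorem posDef (h : IsInducedOn g x F Ω) (hy : y ∈ Ω) : (metricCoeff g x y).PosDef := by
  have : metricCoeff g x y = Matrix.gram ℝ (coordVec F y) := by
    ext i j
    rw [h.metricCoeff_eq y hy, Matrix.gram_apply]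
  rw [this]
  exact Matrix.posDef_gram_of_linearIndependent (h.linearIndependent hy)

theorem fderiv_hasFDerivAt (h : IsInducedOn g x F Ω) (hy : y ∈ Ω) :
    HasFDerivAt (fderiv ℝ F) (fderiv ℝ (fderiv ℝ F) y) y :=
  (((h.contDiffAt y hy).fderiv_right (m := 1) (by norm_cast)).differentiableAt
    (by simp)).hasFDerivAt

theorem fderiv_fderiv_hasFDerivAt (h : IsInducedOn g x F Ω) (hy : y ∈ Ω) :
    HasFDerivAt (fderiv ℝ (fderiv ℝ F)) (fderiv ℝ (fderiv ℝ (fderiv ℝ F)) y) y :=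
  ((((h.contDiffAt y hy).fderiv_right (m := 2) (by norm_cast)).fderiv_right (m := 1)
    (by norm_num)).differentiableAt (by simp)).hasFDerivAt

theorem sndPartial_comm (h : IsInducedOn g x F Ω) (hy : y ∈ Ω) (i j : Fin n) :
    sndPartial F y i j = sndPartial F y j i :=
  (h.contDiffAt y hy).snd_fderiv_comm (by norm_cast) _ _

theorem hasFDerivAt_coordVec (h : IsInducedOn g x F Ω) (hy : y ∈ Ω) (i : Fin n) :
    HasFDerivAt (fun z => coordVec F z i)
      ((fderiv ℝ (fderiv ℝ F) y).flip (EuclideanSpace.single i 1)) y := by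
  simpa using (h.fderiv_hasFDerivAt hy).clm_apply
    (hasFDerivAt_const (EuclideanSpace.single i (1 : ℝ)) y)

theorem hasFDerivAt_sndPartial (h : IsInducedOn g x F Ω) (hy : y ∈ Ω) (i j : Fin n) :
    HasFDerivAt (fun z => sndPartial F z i j)
      (((fderiv ℝ (fderiv ℝ (fderiv ℝ F)) y).flip (EuclideanSpace.single i 1)).flip
        (EuclideanSpace.single j 1)) y := by
  simpa using ((h.fderiv_fderiv_hasFDerivAt hy).clm_apply
    (hasFDerivAt_const (EuclideanSpace.single i (1 : ℝ)) y)).clm_apply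
    (hasFDerivAt_const (EuclideanSpace.single j (1 : ℝ)) y)

theorem hasFDerivAt_metricCoeff (h : IsInducedOn g x F Ω) (hy : y ∈ Ω) (i j : Fin n) :
    ∃ T : Euc n →L[ℝ] ℝ, HasFDerivAt (fun z => metricCoeff g x z i j) T y ∧
      ∀ k, T (EuclideanSpace.single k 1) = inner ℝ (sndPartial F y k i) (coordVec F y j)
        + inner ℝ (coordVec F y i) (sndPartial F y k j) := by
  have h1 := (h.hasFDerivAt_coordVec hy i).inner ℝ (h.hasFDerivAt_coordVec hy j)
  refine ⟨_, h1.congr_of_eventuallyEq ?_, fun k => ?_⟩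
  · filter_upwards [h.isOpen.mem_nhds hy] with z hz using h.metricCoeff_eq z hz i j
  · simp [fderivInnerCLM_apply, add_comm]

theorem partialDeriv_metricCoeff (h : IsInducedOn g x F Ω) (hy : y ∈ Ω) (i j k : Fin n) :
    partialDeriv k (fun z => metricCoeff g x z i j) y =
      inner ℝ (sndPartial F y k i) (coordVec F y j)
        + inner ℝ (coordVec F y i) (sndPartial F y k j) := by
  obtain ⟨T, hT, hk⟩ := h.hasFDerivAt_metricCoeff hy i j
  rw [partialDeriv, hT.fderiv, hk]

/-- After expanding the three derivatives of the Gram matrix, symmetry of the second partials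
cancels all terms except two copies of `⟪F_ij, F_l⟫`. -/
theorem christoffel_eq (h : IsInducedOn g x F Ω) (hy : y ∈ Ω) (k i j : Fin n) :
    christoffel g x k i j y =
      ∑ l, (metricCoeff g x y)⁻¹ k l * inner ℝ (sndPartial F y i j) (coordVec F y l) := by
  rw [christoffel, Finset.mul_sum]
  refine Finset.sum_congr rfl fun l _ => ?_
  rw [h.partialDeriv_metricCoeff hy, h.partialDeriv_metricCoeff hy,
    h.partialDeriv_metricCoeff hy, h.sndPartial_comm hy j i, h.sndPartial_comm hy l i,
    h.sndPartial_comm hy l j, real_inner_comm (coordVec F y j)]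
  ring

theorem christoffel_comm (h : IsInducedOn g x F Ω) (hy : y ∈ Ω) (k i j : Fin n) :
    christoffel g x k i j y = christoffel g x k j i y := by
  rw [h.christoffel_eq hy, h.christoffel_eq hy, h.sndPartial_comm hy]

theorem differentiableAt_christoffel (h : IsInducedOn g x F Ω) (hy : y ∈ Ω) (k i j : Fin n) :
    DifferentiableAt ℝ (christoffel g x k i j) y := by
  have h1 : christoffel g x k i j =ᶠ[𝓝 y] fun z =>
      ∑ l, (metricCoeff g x z)⁻¹ k l * inner ℝ (sndPartial F z i j) (coordVec F z l) := by
    filter_upwards [h.isOpen.mem_nhds hy] with z hz using h.christoffel_eq hz k i j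
  refine DifferentiableAt.congr_of_eventuallyEq (DifferentiableAt.fun_sum fun l _ => ?_) h1
  refine (differentiableAt_matrix_inv (fun a b => ?_) (h.posDef hy).det_pos.ne' k l).mul ?_
  · obtain ⟨T, hT, -⟩ := h.hasFDerivAt_metricCoeff hy a b
    exact hT.differentiableAt
  · exact (h.hasFDerivAt_sndPartial hy i j).differentiableAt.inner ℝ
      (h.hasFDerivAt_coordVec hy l).differentiableAt

end IsInducedOn

variable (g : RiemMetric n M) (x : M) (F : Euc n → Euc N)

/-- The normal part of the second partial derivatives of `F`, by the Gauss formula. -/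
def sndNormal (y : Euc n) (i j : Fin n) : Euc N :=
  sndPartial F y i j - ∑ m, christoffel g x m i j y • coordVec F y m

variable {g x F} {Ω : Set (Euc n)} {y : Euc n}

namespace IsInducedOn

/-- Multiplying `christoffel_eq` by the Gram matrix shows that the Christoffel symbols solve the
normal equations for the tangential projection of `F_ij`. -/
theorem inner_sndNormal_coordVec (h : IsInducedOn g x F Ω) (hy : y ∈ Ω) (i j l : Fin n) :
    inner ℝ (sndNormal g x F y i j) (coordVec F y l) = 0 := by
  have hu : IsUnit (metricCoeff g x y).det := isUnit_iff_ne_zero.2 (h.posDef hy).det_pos.ne'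
  have h1 := Matrix.mul_nonsing_inv _ hu
  have h2 : ∑ m, metricCoeff g x y l m * christoffel g x m i j y =
      inner ℝ (sndPartial F y i j) (coordVec F y l) := by
    have h3 : (fun m => christoffel g x m i j y) = (metricCoeff g x y)⁻¹.mulVec
        (fun l => inner ℝ (sndPartial F y i j) (coordVec F y l)) := by
      funext m
      rw [h.christoffel_eq hy]
      rfl
    have h4 : (metricCoeff g x y).mulVec (fun m => christoffel g x m i j y) =
        fun l => inner ℝ (sndPartial F y i j) (coordVec F y l) := by
      rw [h3, Matrix.mulVec_mulVec, h1, Matrix.one_mulVec]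
    exact congrFun h4 l
  rw [sndNormal, inner_sub_left, sum_inner, ← h2, sub_eq_zero]
  refine Finset.sum_congr rfl fun m _ => ?_
  rw [real_inner_smul_left, h.metricCoeff_eq y hy, real_inner_comm]
  ring

theorem sndNormal_comm (h : IsInducedOn g x F Ω) (hy : y ∈ Ω) (i j : Fin n) :
    sndNormal g x F y i j = sndNormal g x F y j i := by
  simp only [sndNormal, h.christoffel_comm hy _ i j, h.sndPartial_comm hy i j]

/-- The derivative of the Christoffel symbols. -/
theorem partialDeriv_christoffel (h : IsInducedOn g x F Ω) (hy : y ∈ Ω) (c a i j : Fin n) :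
    partialDeriv c (christoffel g x a i j) y =
      ∑ l, (metricCoeff g x y)⁻¹ a l *
        (inner ℝ (fderiv ℝ (fderiv ℝ (fderiv ℝ F)) y (EuclideanSpace.single c 1)
          (EuclideanSpace.single i 1) (EuclideanSpace.single j 1)) (coordVec F y l)
          + inner ℝ (sndNormal g x F y i j) (sndPartial F y c l))
      - ∑ m, christoffel g x m i j y * christoffel g x a c m y := by
  have hu : IsUnit (metricCoeff g x y).det := isUnit_iff_ne_zero.2 (h.posDef hy).det_pos.ne'
  -- Differentiating the orthogonality of `sndNormal` and `coordVec` yields the metric matrix times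
  -- the derivative of `Γ`, so no formula for the derivative of the inverse metric is needed.
  have key : ∀ l, ∑ m, metricCoeff g x y l m * partialDeriv c (christoffel g x m i j) y =
      inner ℝ (fderiv ℝ (fderiv ℝ (fderiv ℝ F)) y (EuclideanSpace.single c 1)
          (EuclideanSpace.single i 1) (EuclideanSpace.single j 1)) (coordVec F y l)
        + inner ℝ (sndNormal g x F y i j) (sndPartial F y c l)
        - ∑ m, christoffel g x m i j y * inner ℝ (sndPartial F y c m) (coordVec F y l) := by
    intro l
    have h0 : (fun z => inner ℝ (sndNormal g x F z i j) (coordVec F z l)) =ᶠ[𝓝 y]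
        fun _ => (0 : ℝ) := by
      filter_upwards [h.isOpen.mem_nhds hy] with z hz using h.inner_sndNormal_coordVec hz i j l
    have hα : HasFDerivAt (fun z => sndNormal g x F z i j) _ y :=
      (h.hasFDerivAt_sndPartial hy i j).sub (HasFDerivAt.fun_sum fun m (_ : m ∈ Finset.univ) =>
        (h.differentiableAt_christoffel hy m i j).hasFDerivAt.smul
          (h.hasFDerivAt_coordVec hy m))
    have h1 := (hα.inner ℝ (h.hasFDerivAt_coordVec hy l)).fderiv
    rw [h0.fderiv_eq] at h1
    have h2 := congrArg (fun T => T (EuclideanSpace.single c (1 : ℝ))) h1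
    simp [fderivInnerCLM_apply, inner_sub_left, inner_add_left, sum_inner,
      real_inner_smul_left, Finset.sum_add_distrib] at h2
    have h3 : ∑ m, metricCoeff g x y l m * partialDeriv c (christoffel g x m i j) y =
        ∑ m, fderiv ℝ (christoffel g x m i j) y (EuclideanSpace.single c 1) *
          inner ℝ (coordVec F y m) (coordVec F y l) := by
      refine Finset.sum_congr rfl fun m _ => ?_
      rw [h.metricCoeff_eq y hy, real_inner_comm, partialDeriv]
      ring
    rw [h3]
    linarith
  have h3 := Matrix.nonsing_inv_mul _ hu
  have h4 : (fun a => partialDeriv c (christoffel g x a i j) y) =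
      (metricCoeff g x y)⁻¹.mulVec ((metricCoeff g x y).mulVec
        (fun a => partialDeriv c (christoffel g x a i j) y)) := by
    rw [Matrix.mulVec_mulVec, h3, Matrix.one_mulVec]
  have h5 := congrFun h4 a
  have h6 : (metricCoeff g x y).mulVec (fun a => partialDeriv c (christoffel g x a i j) y) = _ :=
    funext key
  rw [h6] at h5
  simp only [Matrix.mulVec, dotProduct] at h5
  rw [h5]
  simp only [mul_sub, Finset.sum_sub_distrib]
  congr 1
  simp only [h.christoffel_eq hy a c, Finset.mul_sum]
  rw [Finset.sum_comm]
  refine Finset.sum_congr rfl fun m _ => Finset.sum_congr rfl fun l _ => ?_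
  ring

/-- The contracted Gauss equation. -/
theorem ricciCoeff_eq (h : IsInducedOn g x F Ω) (hy : y ∈ Ω) (j k : Fin n) :
    ricciCoeff g x j k y = ∑ i, ∑ l, (metricCoeff g x y)⁻¹ i l *
      (inner ℝ (sndNormal g x F y j k) (sndNormal g x F y i l)
        - inner ℝ (sndNormal g x F y i k) (sndNormal g x F y j l)) := by
  have hn : ∀ a b c d, inner ℝ (sndNormal g x F y a b) (sndNormal g x F y c d) =
      inner ℝ (sndNormal g x F y a b) (sndPartial F y c d) := by
    intro a b c d
    conv_lhs => rw [sndNormal.eq_1 g x F y c d]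
    rw [inner_sub_right, inner_sum]
    simp [real_inner_smul_right, h.inner_sndNormal_coordVec hy]
  rw [ricciCoeff]
  refine Finset.sum_congr rfl fun i _ => ?_
  -- Symmetry of the third derivatives cancels them in the difference of the two derivatives of `Γ`;
  -- the quadratic terms in `Γ` cancel against those in the definition of Ricci.
  have h3 := ((h.contDiffAt y hy).fderiv_right (m := 2) (by norm_cast)).snd_fderiv_comm le_rfl
    (EuclideanSpace.single i 1) (EuclideanSpace.single j 1)
  rw [h.partialDeriv_christoffel hy, h.partialDeriv_christoffel hy, h3]
  simp only [hn, mul_add, mul_sub, Finset.sum_add_distrib, Finset.sum_sub_distrib]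
  simp only [mul_comm (christoffel g x _ _ k y)]
  ring

/-- The Gauss formula. -/
theorem sndNormal_eq (h : IsInducedOn g x F Ω) (hy : y ∈ Ω) (i j : Fin n) :
    sndNormal g x F y i j =
      (LinearMap.range (fderiv ℝ F y).toLinearMap)ᗮ.starProjection (sndPartial F y i j) := by
  symm
  have hsum : ∀ u : Euc n, fderiv ℝ F y u = ∑ l, u l • coordVec F y l := by
    intro u
    conv_lhs => rw [← (EuclideanSpace.basisFun (Fin n) ℝ).sum_repr u]
    simp
  apply Submodule.eq_starProjection_of_mem_orthogonal
  · rw [Submodule.mem_orthogonal]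
    rintro _ ⟨u, rfl⟩
    rw [real_inner_comm]
    change inner ℝ _ (fderiv ℝ F y u) = 0
    rw [hsum, inner_sum]
    simp [real_inner_smul_right, h.inner_sndNormal_coordVec hy]
  · apply Submodule.le_orthogonal_orthogonal
    rw [sndNormal, sub_sub_cancel]
    exact Submodule.sum_mem _ fun m _ => Submodule.smul_mem _ _ ⟨_, rfl⟩

/-- The Ricci curvature of an induced metric in a direction that is isotropic for the second
fundamental form. -/
theorem sum_ricciCoeff_eq (h : IsInducedOn g x F Ω) (hy : y ∈ Ω) (v : Euc n)
    (hv : (LinearMap.range (fderiv ℝ F y).toLinearMap)ᗮ.starProjection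
      (fderiv ℝ (fderiv ℝ F) y v v) = 0) :
    ∑ j, ∑ k, ricciCoeff g x j k y * v j * v k = - ∑ i, ∑ l, (metricCoeff g x y)⁻¹ i l *
      inner ℝ ((LinearMap.range (fderiv ℝ F y).toLinearMap)ᗮ.starProjection
          (fderiv ℝ (fderiv ℝ F) y (EuclideanSpace.single i 1) v))
        ((LinearMap.range (fderiv ℝ F y).toLinearMap)ᗮ.starProjection
          (fderiv ℝ (fderiv ℝ F) y (EuclideanSpace.single l 1) v)) := by
  set P := (LinearMap.range (fderiv ℝ F y).toLinearMap)ᗮ.starProjection with hP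
  have hvs : v = ∑ k, v k • EuclideanSpace.single k (1 : ℝ) := by
    conv_lhs => rw [← (EuclideanSpace.basisFun (Fin n) ℝ).sum_repr v]
    simp
  have h1 : ∀ u, P (fderiv ℝ (fderiv ℝ F) y u v) =
      ∑ k, v k • P (fderiv ℝ (fderiv ℝ F) y u (EuclideanSpace.single k 1)) := by
    intro u
    conv_lhs => rw [hvs]
    simp
  -- Isotropy of `v` in coordinates; it kills the term of the Gauss equation containing the trace of
  -- `α`.
  have h2 : ∑ j, ∑ k, (v j * v k) • sndNormal g x F y j k = 0 := by
    rw [← hv, h1]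
    conv_rhs => enter [2, k, 2]; rw [hvs]
    simp only [map_sum, map_smul, sum_apply, smul_apply,
      Finset.smul_sum, smul_smul]
    rw [Finset.sum_comm]
    refine Finset.sum_congr rfl fun k _ => Finset.sum_congr rfl fun j _ => ?_
    rw [h.sndNormal_eq hy, mul_comm]
  have h3 : ∀ i, P (fderiv ℝ (fderiv ℝ F) y (EuclideanSpace.single i 1) v) =
      ∑ k, v k • sndNormal g x F y i k := by
    intro i
    rw [h1]
    exact Finset.sum_congr rfl fun k _ => by rw [h.sndNormal_eq hy]
  have h4 : ∀ i l, ∑ j, ∑ k, (inner ℝ (sndNormal g x F y j k) (sndNormal g x F y i l)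
      - inner ℝ (sndNormal g x F y i k) (sndNormal g x F y j l)) * v j * v k =
      - inner ℝ (∑ k, v k • sndNormal g x F y i k) (∑ k, v k • sndNormal g x F y l k) := by
    intro i l
    have h5 : ∑ j, ∑ k, inner ℝ (sndNormal g x F y j k) (sndNormal g x F y i l) * v j * v k = 0 := by
      have := congrArg (fun w => inner ℝ w (sndNormal g x F y i l)) h2
      simp only [sum_inner, real_inner_smul_left, inner_zero_left] at this
      rw [← this]
      refine Finset.sum_congr rfl fun j _ => Finset.sum_congr rfl fun k _ => ?_
      ring
    simp only [sub_mul, Finset.sum_sub_distrib]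
    rw [h5, zero_sub, neg_inj, Finset.sum_comm, sum_inner]
    refine Finset.sum_congr rfl fun j _ => ?_
    rw [inner_sum]
    refine Finset.sum_congr rfl fun k _ => ?_
    rw [real_inner_smul_left, real_inner_smul_right, h.sndNormal_comm hy l k]
    ring
  simp only [h3, h.ricciCoeff_eq hy, Finset.sum_mul]
  calc _ = ∑ i, ∑ l, (metricCoeff g x y)⁻¹ i l * ∑ j, ∑ k,
        (inner ℝ (sndNormal g x F y j k) (sndNormal g x F y i l)
          - inner ℝ (sndNormal g x F y i k) (sndNormal g x F y j l)) * v j * v k := by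
        simp only [Finset.mul_sum]
        rw [Finset.sum_congr rfl fun j _ => Finset.sum_comm, Finset.sum_comm]
        refine Finset.sum_congr rfl fun i _ => ?_
        rw [Finset.sum_congr rfl fun j _ => Finset.sum_comm, Finset.sum_comm]
        refine Finset.sum_congr rfl fun l _ => Finset.sum_congr rfl fun j _ =>
          Finset.sum_congr rfl fun k _ => ?_
        ring
    _ = _ := by simp only [h4, mul_neg, Finset.sum_neg_distrib]

/-- The Ricci curvature of an induced metric is nonpositive in the directions that are isotropic for
the second fundamental form. -/
theorem sum_ricciCoeff_nonpos (h : IsInducedOn g x F Ω) (hy : y ∈ Ω) (v : Euc n)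
    (hv : (LinearMap.range (fderiv ℝ F y).toLinearMap)ᗮ.starProjection
      (fderiv ℝ (fderiv ℝ F) y v v) = 0) :
    ∑ j, ∑ k, ricciCoeff g x j k y * v j * v k ≤ 0 ∧
    (∑ j, ∑ k, ricciCoeff g x j k y * v j * v k = 0 → ∀ u,
      (LinearMap.range (fderiv ℝ F y).toLinearMap)ᗮ.starProjection
        (fderiv ℝ (fderiv ℝ F) y u v) = 0) := by
  rw [h.sum_ricciCoeff_eq hy v hv]
  set P := (LinearMap.range (fderiv ℝ F y).toLinearMap)ᗮ.starProjection with hP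
  set A : Fin n → Euc N := fun i =>
    P (fderiv ℝ (fderiv ℝ F) y (EuclideanSpace.single i 1) v) with hA
  have hpos : (metricCoeff g x y)⁻¹.PosDef := (h.posDef hy).inv
  have hform : ∀ c : Fin n → ℝ, ∑ i, ∑ l, (metricCoeff g x y)⁻¹ i l * (c i * c l) =
      star c ⬝ᵥ ((metricCoeff g x y)⁻¹.mulVec c) := by
    intro c
    simp only [dotProduct, Matrix.mulVec, Finset.mul_sum, star_trivial]
    refine Finset.sum_congr rfl fun i _ => Finset.sum_congr rfl fun l _ => ?_
    ring
  -- Splitting the inner product over the coordinates `b` of `ℝᴺ` reduces the claim to positivity of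
  -- the scalar form `g⁻¹`, with no orthonormal tangent frame.
  have hq : ∀ b : Fin N, 0 ≤ ∑ i, ∑ l, (metricCoeff g x y)⁻¹ i l * (A i b * A l b) := by
    intro b
    rw [hform fun i => A i b]
    exact hpos.posSemidef.dotProduct_mulVec_nonneg _
  have hsum : ∑ i, ∑ l, (metricCoeff g x y)⁻¹ i l * inner ℝ (A i) (A l) =
      ∑ b, ∑ i, ∑ l, (metricCoeff g x y)⁻¹ i l * (A i b * A l b) := by
    conv_rhs => rw [Finset.sum_comm]
    refine Finset.sum_congr rfl fun i _ => ?_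
    conv_rhs => rw [Finset.sum_comm]
    refine Finset.sum_congr rfl fun l _ => ?_
    rw [← Finset.mul_sum, PiLp.inner_apply]
    simp [mul_comm]
  rw [hsum]
  refine ⟨neg_nonpos.2 (Finset.sum_nonneg fun b _ => hq b), fun h0 u => ?_⟩
  rw [neg_eq_zero, Finset.sum_eq_zero_iff_of_nonneg fun b _ => hq b] at h0
  have hA0 : ∀ i, A i = 0 := by
    intro i
    ext b
    by_contra hb
    have h1 := hpos.dotProduct_mulVec_pos (x := fun i => A i b) fun h => hb (congrFun h i)
    rw [← hform, h0 b (Finset.mem_univ b)] at h1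
    exact lt_irrefl _ h1
  have hus : u = ∑ k, u k • EuclideanSpace.single k (1 : ℝ) := by
    conv_lhs => rw [← (EuclideanSpace.basisFun (Fin n) ℝ).sum_repr u]
    simp
  rw [hus]
  simp only [map_sum, map_smul, sum_apply, smul_apply]
  exact Finset.sum_eq_zero fun k _ => by rw [show P _ = 0 from hA0 k, smul_zero]

end IsInducedOn

end Gauss

/-! ### Derivatives of maps on `M` read in charts. -/

section ChartExpressions

variable {n N : ℕ} {M : Type*} [TopologicalSpace M] [ChartedSpace (Euc n) M]

/-- The expression of `h` in the preferred chart at `x`. -/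
abbrev chartExpr (h : M → Euc N) (x : M) : Euc n → Euc N :=
  h ∘ (extChartAt (𝓡 n) x).symm

variable [IsManifold (𝓡 n) ∞ M]

theorem contMDiffAt_extChartAt_symm_of_mem (x : M) {y : Euc n}
    (hy : y ∈ (extChartAt (𝓡 n) x).target) :
    ContMDiffAt 𝓘(ℝ, Euc n) (𝓡 n) ∞ (extChartAt (𝓡 n) x).symm y :=
  (contMDiffOn_extChartAt_symm x).contMDiffAt ((isOpen_extChartAt_target x).mem_nhds hy)

theorem contMDiffAt_extChartAt_of_mem (x : M) {z : M} (hz : z ∈ (extChartAt (𝓡 n) x).source) :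
    ContMDiffAt (𝓡 n) 𝓘(ℝ, Euc n) ∞ (extChartAt (𝓡 n) x) z :=
  contMDiffAt_extChartAt' (by simpa using hz)

theorem contDiffAt_chartExpr {h : M → Euc N} (x : M) {y : Euc n}
    (hy : y ∈ (extChartAt (𝓡 n) x).target)
    (hh : ContMDiffAt (𝓡 n) 𝓘(ℝ, Euc N) ∞ h ((extChartAt (𝓡 n) x).symm y)) :
    ContDiffAt ℝ ∞ (chartExpr h x) y :=
  (hh.comp y (contMDiffAt_extChartAt_symm_of_mem x hy)).contDiffAt

theorem fderiv_chartExpr {h : M → Euc N} (x : M) {y : Euc n}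
    (hy : y ∈ (extChartAt (𝓡 n) x).target)
    (hh : ContMDiffAt (𝓡 n) 𝓘(ℝ, Euc N) ∞ h ((extChartAt (𝓡 n) x).symm y)) (u : Euc n) :
    fderiv ℝ (chartExpr h x) y u = diff h ((extChartAt (𝓡 n) x).symm y)
      (mfderiv 𝓘(ℝ, Euc n) (𝓡 n) (extChartAt (𝓡 n) x).symm y u) := by
  rw [← mfderiv_eq_fderiv]
  exact mfderiv_comp_apply y (hh.mdifferentiableAt (by simp))
    ((contMDiffAt_extChartAt_symm_of_mem x hy).mdifferentiableAt (by simp)) u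

theorem diff_eq_fderiv_chartExpr {h : M → Euc N} (x : M) {z : M}
    (hz : z ∈ (extChartAt (𝓡 n) x).source)
    (hh : ContMDiffAt (𝓡 n) 𝓘(ℝ, Euc N) ∞ h z) (X : TangentSpace (𝓡 n) z) :
    diff h z X = fderiv ℝ (chartExpr h x) (extChartAt (𝓡 n) x z)
      (mfderiv (𝓡 n) 𝓘(ℝ, Euc n) (extChartAt (𝓡 n) x) z X) := by
  have hy := (extChartAt (𝓡 n) x).map_source hz
  have hzz : (extChartAt (𝓡 n) x).symm (extChartAt (𝓡 n) x z) = z :=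
    (extChartAt (𝓡 n) x).left_inv hz
  have hev : h =ᶠ[𝓝 z] chartExpr h x ∘ extChartAt (𝓡 n) x := by
    filter_upwards [(isOpen_extChartAt_source x).mem_nhds hz] with w hw
    exact congrArg h ((extChartAt (𝓡 n) x).left_inv hw).symm
  have hd : ContDiffAt ℝ ∞ (chartExpr h x) (extChartAt (𝓡 n) x z) :=
    contDiffAt_chartExpr x hy (by rwa [hzz])
  rw [diff, hev.mfderiv_eq, ← mfderiv_eq_fderiv]
  exact mfderiv_comp_apply z (hd.contMDiffAt.mdifferentiableAt (by simp))
    ((contMDiffAt_extChartAt_of_mem x hz).mdifferentiableAt (by simp)) X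

theorem bijective_mfderiv_extChartAt (x : M) {z : M} (hz : z ∈ (extChartAt (𝓡 n) x).source) :
    Function.Bijective (mfderiv (𝓡 n) 𝓘(ℝ, Euc n) (extChartAt (𝓡 n) x) z) := by
  have : IsManifold (𝓡 n) 1 M := IsManifold.of_le (n := ∞) (by norm_cast)
  exact (isInvertible_mfderiv_extChartAt hz).bijective

theorem bijective_mfderiv_extChartAt_symm (x : M) {y : Euc n}
    (hy : y ∈ (extChartAt (𝓡 n) x).target) :
    Function.Bijective (mfderiv 𝓘(ℝ, Euc n) (𝓡 n) (extChartAt (𝓡 n) x).symm y) := by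
  have : IsManifold (𝓡 n) 1 M := IsManifold.of_le (n := ∞) (by norm_cast)
  have h := isInvertible_mfderivWithin_extChartAt_symm (I := 𝓡 n) hy
  rw [ModelWithCorners.Boundaryless.range_eq_univ, mfderivWithin_univ] at h
  exact h.bijective

theorem exists_diff_eq_iff {h : M → Euc N} (x : M) {z : M} (hz : z ∈ (extChartAt (𝓡 n) x).source)
    (hh : ContMDiffAt (𝓡 n) 𝓘(ℝ, Euc N) ∞ h z) (w : Euc N) :
    (∃ X, diff (n := n) h z X = w) ↔
      ∃ u, fderiv ℝ (chartExpr h x) (extChartAt (𝓡 n) x z) u = w := by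
  constructor
  · rintro ⟨X, rfl⟩
    exact ⟨_, (diff_eq_fderiv_chartExpr x hz hh X).symm⟩
  · rintro ⟨u, rfl⟩
    obtain ⟨X, rfl⟩ := (bijective_mfderiv_extChartAt x hz).2 u
    exact ⟨X, diff_eq_fderiv_chartExpr x hz hh X⟩

/-- The second derivative of a function along a parametrization. -/
theorem fderiv_fderiv_comp_chartExpr {A : Type*} [NormedAddCommGroup A] [NormedSpace ℝ A]
    {h : M → Euc N} {σ : A → M} {a : A} (x : M) (hx : σ a ∈ (extChartAt (𝓡 n) x).source)
    (hh : ContMDiffAt (𝓡 n) 𝓘(ℝ, Euc N) ∞ h (σ a)) (hσ : ContMDiffAt 𝓘(ℝ, A) (𝓡 n) ∞ σ a) (u v : A) :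
    ∃ w, fderiv ℝ (fderiv ℝ (h ∘ σ)) a u v =
      fderiv ℝ (fderiv ℝ (chartExpr h x)) (extChartAt (𝓡 n) x (σ a))
        (mfderiv (𝓡 n) 𝓘(ℝ, Euc n) (extChartAt (𝓡 n) x) (σ a) (mfderiv 𝓘(ℝ, A) (𝓡 n) σ a u))
        (mfderiv (𝓡 n) 𝓘(ℝ, Euc n) (extChartAt (𝓡 n) x) (σ a) (mfderiv 𝓘(ℝ, A) (𝓡 n) σ a v))
      + diff (n := n) h (σ a) w := by
  have hy := (extChartAt (𝓡 n) x).map_source hx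
  have hzz : (extChartAt (𝓡 n) x).symm (extChartAt (𝓡 n) x (σ a)) = σ a :=
    (extChartAt (𝓡 n) x).left_inv hx
  have hφ := contMDiffAt_extChartAt_of_mem x hx
  have hτ : ContDiffAt ℝ ∞ (extChartAt (𝓡 n) x ∘ σ) a := (hφ.comp a hσ).contDiffAt
  have hF : ContDiffAt ℝ ∞ (chartExpr h x) ((extChartAt (𝓡 n) x ∘ σ) a) :=
    contDiffAt_chartExpr x hy (by rwa [Function.comp_apply, hzz])
  have hev : h ∘ σ =ᶠ[𝓝 a] chartExpr h x ∘ (extChartAt (𝓡 n) x ∘ σ) := by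
    filter_upwards [hσ.continuousAt.eventually ((isOpen_extChartAt_source x).mem_nhds hx)]
      with w hw
    exact congrArg h ((extChartAt (𝓡 n) x).left_inv hw).symm
  have hd : ∀ u, fderiv ℝ (extChartAt (𝓡 n) x ∘ σ) a u =
      mfderiv (𝓡 n) 𝓘(ℝ, Euc n) (extChartAt (𝓡 n) x) (σ a) (mfderiv 𝓘(ℝ, A) (𝓡 n) σ a u) := by
    intro u
    rw [← mfderiv_eq_fderiv]
    exact mfderiv_comp_apply a (hφ.mdifferentiableAt (by simp))
      (hσ.mdifferentiableAt (by simp)) u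
  have h2 : (2 : ℕ∞ω) ≤ ∞ := by norm_cast
  -- The second derivative of the parametrization in the chart contributes only a vector in the
  -- image of the differential of `h`.
  obtain ⟨w, hw⟩ := (exists_diff_eq_iff x hx hh _).2
    ⟨fderiv ℝ (fderiv ℝ (extChartAt (𝓡 n) x ∘ σ)) a u v, rfl⟩
  refine ⟨w, ?_⟩
  rw [hev.fderiv.fderiv_eq, fderiv_fderiv_comp (hF.of_le h2) (hτ.of_le h2), hd, hd, hw]
  rfl

end ChartExpressions

/-! ### The second fundamental form of an isometric immersion. -/

section Immersions

variable {n N : ℕ} {M : Type*} [TopologicalSpace M] [ChartedSpace (Euc n) M] {f : M → Euc N}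

theorem mem_normalSpace_iff {x : M} {ξ : Euc N} :
    ξ ∈ normalSpace n f x ↔ ∀ X, inner ℝ ξ (diff (n := n) f x X) = 0 := by
  rw [normalSpace, Submodule.mem_orthogonal']
  exact ⟨fun h X => h _ ⟨X, rfl⟩, by rintro h _ ⟨X, rfl⟩; exact h X⟩

theorem secondFF_apply (x : M) (v w : TangentSpace (𝓡 n) x) :
    secondFF f x v w = (normalSpace n f x).starProjection
      (fderiv ℝ (fderiv ℝ (chartExpr f x)) (extChartAt (𝓡 n) x x)
        (chartVec x v) (chartVec x w)) := rfl

theorem secondFF_mem_firstNormal (x : M) (v w : TangentSpace (𝓡 n) x) :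
    secondFF f x v w ∈ firstNormal n f x :=
  Submodule.subset_span ⟨v, w, rfl⟩

theorem mem_relNullity_iff {x : M} {v : TangentSpace (𝓡 n) x} :
    v ∈ relNullity f x ↔ ∀ X, secondFF f x v X = 0 := by
  simp [relNullity, Submodule.mem_iInf]

variable [IsManifold (𝓡 n) ∞ M] {g : RiemMetric n M}

theorem IsIsometricImmersion.injective_diff (hf : IsIsometricImmersion g f) (x : M) :
    Function.Injective (diff (n := n) f x) := by
  rw [injective_iff_map_eq_zero]
  intro v hv
  by_contra h
  have h1 := g.pos x v h
  rw [hf.2, hv, inner_zero_left] at h1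
  exact lt_irrefl _ h1

theorem range_diff_eq (hf : ContMDiff (𝓡 n) 𝓘(ℝ, Euc N) ∞ f) (x : M) :
    LinearMap.range (diff (n := n) f x).toLinearMap =
      LinearMap.range (fderiv ℝ (chartExpr (n := n) f x) (extChartAt (𝓡 n) x x)).toLinearMap := by
  ext w
  exact exists_diff_eq_iff x (mem_extChartAt_source x) hf.contMDiffAt w

theorem IsIsometricImmersion.isInducedOn (hf : IsIsometricImmersion g f) (x : M) :
    IsInducedOn g x (chartExpr f x) (extChartAt (𝓡 n) x).target where
  isOpen := isOpen_extChartAt_target x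
  contDiffAt y hy := contDiffAt_chartExpr x hy hf.1.contMDiffAt
  injective y hy := by
    intro u v huv
    rw [fderiv_chartExpr x hy hf.1.contMDiffAt, fderiv_chartExpr x hy hf.1.contMDiffAt] at huv
    exact (bijective_mfderiv_extChartAt_symm x hy).1 (hf.injective_diff _ huv)
  metricCoeff_eq y hy i j := by
    rw [coordVec, coordVec, fderiv_chartExpr x hy hf.1.contMDiffAt,
      fderiv_chartExpr x hy hf.1.contMDiffAt, metricCoeff, Matrix.of_apply, hf.2]

theorem secondFF_comm (hf : ContMDiff (𝓡 n) 𝓘(ℝ, Euc N) ∞ f) (x : M)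
    (v w : TangentSpace (𝓡 n) x) : secondFF f x v w = secondFF f x w v := by
  rw [secondFF_apply, secondFF_apply, (contDiffAt_chartExpr x (mem_extChartAt_target x)
    hf.contMDiffAt).snd_fderiv_comm (by norm_cast)]

/-- Isotropic directions of the second fundamental form have nonpositive Ricci curvature, and they
are in the relative nullity if it vanishes. -/
theorem IsIsometricImmersion.ricci_nonpos (hf : IsIsometricImmersion g f) {x : M}
    {v : TangentSpace (𝓡 n) x} (hv : secondFF f x v v = 0) :
    ricci g x v ≤ 0 ∧ (ricci g x v = 0 → v ∈ relNullity f x) := by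
  have h := (hf.isInducedOn x).sum_ricciCoeff_nonpos (mem_extChartAt_target x) (chartVec x v)
  simp only [← range_diff_eq hf.1 x] at h
  obtain ⟨h1, h2⟩ := h hv
  refine ⟨h1, fun h0 => mem_relNullity_iff.2 fun X => ?_⟩
  rw [secondFF_comm hf.1]
  exact h2 h0 _

/-- A vector orthogonal to the tangent space and to the first normal space is orthogonal to the
second derivatives of the immersion, in every chart. -/
theorem inner_snd_fderiv_of_mem_firstNormalPerp (hf : ContMDiff (𝓡 n) 𝓘(ℝ, Euc N) ∞ f) (x : M)
    {y : Euc n} (hy : y ∈ (extChartAt (𝓡 n) x).target) {ξ : Euc N}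
    (hξ : ξ ∈ firstNormalPerp n f ((extChartAt (𝓡 n) x).symm y)) (u v : Euc n) :
    inner ℝ ξ (fderiv ℝ (fderiv ℝ (chartExpr f x)) y u v) = 0 := by
  set z := (extChartAt (𝓡 n) x).symm y with hz
  -- `secondFF` at `z` uses the chart at `z`, not the one at `x`; passing between them changes
  -- second derivatives by a tangent vector, to which `ξ` is orthogonal.
  obtain ⟨w, hw⟩ := fderiv_fderiv_comp_chartExpr (σ := (extChartAt (𝓡 n) x).symm) (a := y) z
    (mem_extChartAt_source z) hf.contMDiffAt (contMDiffAt_extChartAt_symm_of_mem x hy) u v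
  have h1 := mem_normalSpace_iff.1 hξ.1
  rw [chartExpr, hw, inner_add_right]
  have h3 := Submodule.inner_left_of_mem_orthogonal (secondFF_mem_firstNormal (f := f) z
    (mfderiv 𝓘(ℝ, Euc n) (𝓡 n) (extChartAt (𝓡 n) x).symm y u)
    (mfderiv 𝓘(ℝ, Euc n) (𝓡 n) (extChartAt (𝓡 n) x).symm y v)) hξ.2
  rw [secondFF_apply, ← Submodule.inner_starProjection_left_eq_right,
    Submodule.starProjection_eq_self_iff.2 hξ.1] at h3
  rw [h1 w, add_zero]
  exact h3

end Immersions

/-! ### The Codazzi equation on sections of `N₁^⊥`. -/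

section Codazzi

variable {n N : ℕ} {M : Type*} [TopologicalSpace M] [ChartedSpace (Euc n) M] {f : M → Euc N}

theorem IsSectionPerp.contMDiffAt {O : Set M} {μ : M → Euc N} (hμ : IsSectionPerp n f O μ)
    (hO : IsOpen O) {x : M} (hx : x ∈ O) : ContMDiffAt (𝓡 n) 𝓘(ℝ, Euc N) ∞ μ x :=
  hμ.1.contMDiffAt (hO.mem_nhds hx)

theorem spaceS_le_firstNormal (x : M) : spaceS n f x ≤ firstNormal n f x := by
  rw [spaceS, Submodule.span_le]
  rintro _ ⟨O, μ, X, -, -, -, rfl⟩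
  exact Submodule.starProjection_apply_mem _ _

theorem finrank_tangentSpace (x : M) : Module.finrank ℝ (TangentSpace (𝓡 n) x) = n :=
  finrank_euclideanSpace_fin (𝕜 := ℝ) (n := n)

variable (n) in
/-- The linear maps `X ↦ (∇^⊥_X μ)_{N₁}` at `x`, for the local sections `μ` of `N₁^⊥`. -/
def codazziMaps (f : M → Euc N) (x : M) : Submodule ℝ (TangentSpace (𝓡 n) x →ₗ[ℝ] Euc N) where
  carrier := {φ | ∃ (O : Set M) (μ : M → Euc N), IsOpen O ∧ x ∈ O ∧ IsSectionPerp n f O μ ∧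
    ∀ X, φ X = (firstNormal n f x).starProjection (normalDeriv f μ x X)}
  zero_mem' := by
    refine ⟨univ, fun _ => 0, isOpen_univ, mem_univ x,
      ⟨contMDiffOn_const, fun y _ => Submodule.zero_mem _⟩, fun X => ?_⟩
    have : diff (n := n) (fun _ : M => (0 : Euc N)) x = 0 := mfderiv_const
    simp [normalDeriv, this]
  add_mem' := by
    rintro φ ψ ⟨O₁, μ₁, hO₁, hx₁, hμ₁, hφ⟩ ⟨O₂, μ₂, hO₂, hx₂, hμ₂, hψ⟩
    refine ⟨O₁ ∩ O₂, μ₁ + μ₂, hO₁.inter hO₂, ⟨hx₁, hx₂⟩,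
      ⟨(hμ₁.1.mono inter_subset_left).add (hμ₂.1.mono inter_subset_right), fun y hy =>
        Submodule.add_mem _ (hμ₁.2 y hy.1) (hμ₂.2 y hy.2)⟩, fun X => ?_⟩
    have : diff (n := n) (μ₁ + μ₂) x = diff μ₁ x + diff μ₂ x :=
      mfderiv_add ((hμ₁.contMDiffAt hO₁ hx₁).mdifferentiableAt (by simp))
        ((hμ₂.contMDiffAt hO₂ hx₂).mdifferentiableAt (by simp))
    simp [normalDeriv, this, hφ, hψ]
  smul_mem' := by
    rintro c φ ⟨O, μ, hO, hx, hμ, hφ⟩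
    refine ⟨O, c • μ, hO, hx, ⟨
      (c • ContinuousLinearMap.id ℝ (Euc N)).contMDiff.comp_contMDiffOn hμ.1, fun y hy =>
      Submodule.smul_mem _ c (hμ.2 y hy)⟩, fun X => ?_⟩
    have : diff (n := n) (c • μ) x = c • diff μ x :=
      const_smul_mfderiv ((hμ.contMDiffAt hO hx).mdifferentiableAt (by simp)) c
    simp [normalDeriv, this, hφ]

theorem spaceS_eq_span (x : M) : spaceS n f x =
    Submodule.span ℝ {w | ∃ φ ∈ codazziMaps n f x, ∃ X, w = φ X} := by
  rw [spaceS]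
  congr 1
  ext w
  constructor
  · rintro ⟨O, μ, X, hO, hx, hμ, rfl⟩
    exact ⟨((firstNormal n f x).starProjection ∘L (normalSpace n f x).starProjection ∘L
      diff (n := n) μ x).toLinearMap, ⟨O, μ, hO, hx, hμ, fun _ => rfl⟩, X, rfl⟩
  · rintro ⟨φ, ⟨O, μ, hO, hx, hμ, hφ⟩, X, rfl⟩
    exact ⟨O, μ, X, hO, hx, hμ, hφ X⟩

variable [IsManifold (𝓡 n) ∞ M]

/-- Orthogonality is needed at all nearby points in one fixed chart, because it is going to be
differentiated. -/
theorem IsSectionPerp.eventually_inner_eq_zero (hf : ContMDiff (𝓡 n) 𝓘(ℝ, Euc N) ∞ f) {O : Set M}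
    {μ : M → Euc N} (hμ : IsSectionPerp n f O μ) (hO : IsOpen O) {x : M} (hx : x ∈ O) :
    ∀ᶠ y in 𝓝 (extChartAt (𝓡 n) x x), ∀ u v,
      inner ℝ (chartExpr μ x y) (fderiv ℝ (chartExpr f x) y u) = 0 ∧
      inner ℝ (chartExpr μ x y) (fderiv ℝ (fderiv ℝ (chartExpr f x)) y u v) = 0 := by
  have hc : ContinuousAt (extChartAt (𝓡 n) x).symm (extChartAt (𝓡 n) x x) :=
    continuousAt_extChartAt_symm x
  have hO' : O ∈ 𝓝 ((extChartAt (𝓡 n) x).symm (extChartAt (𝓡 n) x x)) := by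
    rw [extChartAt_to_inv]
    exact hO.mem_nhds hx
  filter_upwards [extChartAt_target_mem_nhds x, hc.eventually hO'] with y hy hyO u v
  refine ⟨?_, inner_snd_fderiv_of_mem_firstNormalPerp hf x hy (hμ.2 _ hyO) u v⟩
  rw [fderiv_chartExpr x hy hf.contMDiffAt]
  exact mem_normalSpace_iff.1 (hμ.2 _ hyO).1 _

/-- The derivative of a section of `N₁^⊥` is normal. -/
theorem IsSectionPerp.diff_mem_normalSpace (hf : ContMDiff (𝓡 n) 𝓘(ℝ, Euc N) ∞ f) {O : Set M}
    {μ : M → Euc N} (hμ : IsSectionPerp n f O μ) (hO : IsOpen O) {x : M} (hx : x ∈ O)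
    (X : TangentSpace (𝓡 n) x) : diff μ x X ∈ normalSpace n f x := by
  rw [mem_normalSpace_iff]
  intro Y
  have hxs := mem_extChartAt_source (I := 𝓡 n) x
  have hxt := mem_extChartAt_target (I := 𝓡 n) x
  rw [diff_eq_fderiv_chartExpr x hxs hf.contMDiffAt,
    diff_eq_fderiv_chartExpr x hxs (hμ.contMDiffAt hO hx)]
  have hev := hμ.eventually_inner_eq_zero hf hO hx
  refine inner_fderiv_eq_zero ((contDiffAt_chartExpr x hxt hf.contMDiffAt).of_le (by norm_cast))
    ((contDiffAt_chartExpr x hxt (by rw [extChartAt_to_inv]; exact hμ.contMDiffAt hO hx)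
      ).differentiableAt (by simp)) _ _ ?_ (hev.self_of_nhds _ _).2
  filter_upwards [hev] with y hy using (hy _ 0).1

/-- The Codazzi equation for sections of `N₁^⊥`. -/
theorem IsSectionPerp.inner_secondFF_comm (hf : ContMDiff (𝓡 n) 𝓘(ℝ, Euc N) ∞ f) {O : Set M}
    {μ : M → Euc N} (hμ : IsSectionPerp n f O μ) (hO : IsOpen O) {x : M} (hx : x ∈ O)
    (X Y Z : TangentSpace (𝓡 n) x) :
    inner ℝ (secondFF f x X Y) ((firstNormal n f x).starProjection (normalDeriv f μ x Z)) =
      inner ℝ (secondFF f x Z Y) ((firstNormal n f x).starProjection (normalDeriv f μ x X)) := by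
  have hxs := mem_extChartAt_source (I := 𝓡 n) x
  have hxt := mem_extChartAt_target (I := 𝓡 n) x
  have hμx := hμ.contMDiffAt hO hx
  -- Every projection drops out: `α` has values in `N₁` and the derivative of `μ` is already normal.
  have key : ∀ X Y Z : TangentSpace (𝓡 n) x,
      inner ℝ (secondFF f x X Y) ((firstNormal n f x).starProjection (normalDeriv f μ x Z)) =
      inner ℝ (fderiv ℝ (fderiv ℝ (chartExpr f x)) (extChartAt (𝓡 n) x x)
        (chartVec x X) (chartVec x Y))
        (fderiv ℝ (chartExpr μ x) (extChartAt (𝓡 n) x x) (chartVec x Z)) := by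
    intro X Y Z
    have hn := hμ.diff_mem_normalSpace hf hO hx Z
    rw [← Submodule.inner_starProjection_left_eq_right,
      Submodule.starProjection_eq_self_iff.2 (secondFF_mem_firstNormal x X Y), normalDeriv,
      Submodule.starProjection_eq_self_iff.2 hn, secondFF_apply,
      Submodule.inner_starProjection_left_eq_right, Submodule.starProjection_eq_self_iff.2 hn,
      diff_eq_fderiv_chartExpr x hxs hμx]
    rfl
  rw [key, key]
  refine inner_snd_fderiv_comm
    ((contDiffAt_chartExpr x hxt hf.contMDiffAt).of_le (by norm_cast))
    ((contDiffAt_chartExpr x hxt (by rwa [extChartAt_to_inv])).differentiableAt (by simp)) ?_ _ _ _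
  filter_upwards [hμ.eventually_inner_eq_zero hf hO hx] with y hy u v using (hy u v).2

/-- If `𝒮` is all of the first normal space and of dimension less than `n`, then the second
fundamental form has a nonzero isotropic vector. -/
theorem exists_isotropic_of_spaceS_eq (hf : ContMDiff (𝓡 n) 𝓘(ℝ, Euc N) ∞ f) (x : M)
    (hS : spaceS n f x = firstNormal n f x) (hdim : Module.finrank ℝ (spaceS n f x) < n) :
    ∃ X : TangentSpace (𝓡 n) x, X ≠ 0 ∧ secondFF f x X X = 0 := by
  have : FiniteDimensional ℝ (TangentSpace (𝓡 n) x) :=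
    inferInstanceAs (FiniteDimensional ℝ (Euc n))
  refine exists_isotropic (codazziMaps n f x) (fun X Y => secondFF f x X Y)
    (secondFF_comm hf x) ?_ (spaceS n f x) (spaceS_eq_span x)
    (fun X Y => hS ▸ secondFF_mem_firstNormal x X Y) (by rwa [finrank_tangentSpace])
  rintro φ ⟨O, μ, hO, hx, hμ, hφ⟩ X Y Z
  rw [hφ, hφ]
  exact hμ.inner_secondFF_comm hf hO hx X Y Z

end Codazzi

/-! ### Rulings give isotropic directions. -/

section Rulings

variable {n N : ℕ}

/-- The derivatives of a map into an affine subspace take values in its direction. -/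
theorem fderiv_mem_direction {A C : Type*} [NormedAddCommGroup A] [NormedSpace ℝ A]
    [NormedAddCommGroup C] [InnerProductSpace ℝ C] [FiniteDimensional ℝ C] {h : A → C}
    {L : AffineSubspace ℝ C} {a : A} (hh : ContDiffAt ℝ 2 h a) (hL : ∀ᶠ z in 𝓝 a, h z ∈ L)
    (u v : A) :
    fderiv ℝ h a u ∈ L.direction ∧ fderiv ℝ (fderiv ℝ h) a u v ∈ L.direction := by
  have hd : ∀ᶠ z in 𝓝 a, DifferentiableAt ℝ h z := by
    filter_upwards [hh.eventually (by simp)] with z hz using hz.differentiableAt (by simp)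
  have hd2 : DifferentiableAt ℝ (fderiv ℝ h) a :=
    (hh.fderiv_right (m := 1) (by norm_num)).differentiableAt (by simp)
  -- Pairing `h` with a vector orthogonal to the direction of `L` gives a locally constant function.
  have key : ∀ ξ ∈ L.directionᗮ, ∀ᶠ z in 𝓝 a, ∀ v, inner ℝ ξ (fderiv ℝ h z v) = 0 := by
    intro ξ hξ
    filter_upwards [hL.eventually_nhds, hd] with z hz hdz v
    have h0 : (fun y => inner ℝ ξ (h y)) =ᶠ[𝓝 z] fun _ => inner ℝ ξ (h z) := by
      filter_upwards [hz] with y hy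
      have h1 := Submodule.inner_left_of_mem_orthogonal
        (AffineSubspace.vsub_mem_direction hy hz.self_of_nhds) hξ
      rw [vsub_eq_sub, inner_sub_right] at h1
      linarith
    have h1 := ((innerSL ℝ ξ).hasFDerivAt.comp z hdz.hasFDerivAt).fderiv
    have h2 : fderiv ℝ (innerSL ℝ ξ ∘ h) z = 0 := h0.fderiv_eq.trans (by simp)
    rw [h2] at h1
    exact (congrArg (fun T => T v) h1).symm
  constructor
  · rw [← Submodule.orthogonal_orthogonal L.direction, Submodule.mem_orthogonal]
    exact fun ξ hξ => (key ξ hξ).self_of_nhds u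
  · rw [← Submodule.orthogonal_orthogonal L.direction, Submodule.mem_orthogonal]
    intro ξ hξ
    have h0 : (fun z => inner ℝ ξ (fderiv ℝ h z v)) =ᶠ[𝓝 a] fun _ => (0 : ℝ) := by
      filter_upwards [key ξ hξ] with z hz using hz v
    have h1 := ((innerSL ℝ ξ).hasFDerivAt.comp a
      (hd2.hasFDerivAt.clm_apply (hasFDerivAt_const v a))).fderiv
    have h2 : fderiv ℝ (innerSL ℝ ξ ∘ fun z => fderiv ℝ h z v) a = 0 :=
      h0.fderiv_eq.trans (by simp)
    rw [h2] at h1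
    simpa using (congrArg (fun T => T u) h1).symm

variable {M : Type*} [TopologicalSpace M] [ChartedSpace (Euc n) M]

/-- The points of a small integral manifold through `x` are in the leaf of `x`. -/
theorem mem_leaf_of_integralManifold {U : Set M}
    {D : ∀ x : M, Submodule ℝ (TangentSpace (𝓡 n) x)} {d : ℕ} {W : Set (Euc d)} {σ : Euc d → M}
    (hW : IsOpen W) (hσ : ContMDiffOn 𝓘(ℝ, Euc d) (𝓡 n) ∞ σ W)
    (hD : ∀ w ∈ W, σ w ∈ U ∧
      LinearMap.range (mfderiv 𝓘(ℝ, Euc d) (𝓡 n) σ w).toLinearMap ≤ D (σ w))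
    {ε : ℝ} (hε : Metric.ball 0 ε ⊆ W) {w : Euc d} (hw : w ∈ Metric.ball 0 ε) :
    σ w ∈ leaf U D (σ 0) := by
  -- Curves in a leaf are defined on all of `ℝ`. The sine joins `0` at `t = 0` to `w` at `t = 1`
  -- without ever leaving the ball.
  let c : ℝ → Euc d := fun t => Real.sin (Real.pi / 2 * t) • w
  have hc : ContDiff ℝ ∞ c := by
    have h1 : ContDiff ℝ ∞ fun t : ℝ => Real.sin (Real.pi / 2 * t) :=
      Real.contDiff_sin.comp (contDiff_const.mul contDiff_id)
    exact h1.smul contDiff_const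
  have hcW : ∀ t, c t ∈ W := by
    intro t
    apply hε
    rw [mem_ball_zero_iff] at hw ⊢
    refine lt_of_le_of_lt ?_ hw
    rw [norm_smul]
    exact mul_le_of_le_one_left (norm_nonneg _) (Real.abs_sin_le_one _)
  have hσt : ∀ t, ContMDiffAt 𝓘(ℝ, Euc d) (𝓡 n) ∞ σ (c t) := fun t =>
    hσ.contMDiffAt (hW.mem_nhds (hcW t))
  refine ⟨σ ∘ c, fun t => (hσt t).comp t hc.contDiffAt.contMDiffAt, by simp [c], by simp [c],
    fun t => ⟨(hD _ (hcW t)).1, ?_⟩⟩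
  rintro _ ⟨r, rfl⟩
  apply (hD _ (hcW t)).2
  refine ⟨mfderiv 𝓘(ℝ, ℝ) 𝓘(ℝ, Euc d) c t r, ?_⟩
  exact (mfderiv_comp_apply t ((hσt t).mdifferentiableAt (by simp))
    (hc.contDiffAt.contMDiffAt.mdifferentiableAt (by simp)) r).symm

variable [IsManifold (𝓡 n) ∞ M] {g : RiemMetric n M} {f : M → Euc N}

/-- The directions of the rulings are isotropic for the second fundamental form. -/
theorem IsRuled.secondFF_eq_zero (hf : IsIsometricImmersion g f) {U : Set M}
    {D : ∀ x : M, Submodule ℝ (TangentSpace (𝓡 n) x)} {d : ℕ} (h : IsRuled f U D d) {x : M}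
    (hx : x ∈ U) {v : TangentSpace (𝓡 n) x} (hv : v ∈ D x) : secondFF f x v v = 0 := by
  obtain ⟨hsm, hint, hleaf⟩ := h
  obtain ⟨W, σ, hW, h0W, hσ, rfl, hD⟩ := hint x hx
  obtain ⟨L, O, hL, -, hLO⟩ := hleaf _ hx
  obtain ⟨ε, hε, hball⟩ := Metric.isOpen_iff.1 hW 0 h0W
  have hmem : ∀ᶠ w in 𝓝 (0 : Euc d), (f ∘ σ) w ∈ L := by
    filter_upwards [Metric.ball_mem_nhds 0 hε] with w hw
    have h1 : f (σ w) ∈ f '' leaf U D (σ 0) := mem_image_of_mem f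
      (mem_leaf_of_integralManifold hW hσ (fun w hw => ⟨(hD w hw).1, (hD w hw).2.le⟩) hball hw)
    rw [hLO] at h1
    exact h1.2
  have hσ0 : ContMDiffAt 𝓘(ℝ, Euc d) (𝓡 n) ∞ σ 0 := hσ.contMDiffAt (hW.mem_nhds h0W)
  have hh : ContDiffAt ℝ 2 (f ∘ σ) 0 :=
    ((hf.1.contMDiffAt.comp 0 hσ0).contDiffAt).of_le (by norm_cast)
  -- The inclusion comes from first derivatives along the leaf; both sides have dimension `d`.
  have hDL : (D (σ 0)).map (diff (n := n) f (σ 0)).toLinearMap = L.direction := by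
    apply Submodule.eq_of_le_of_finrank_eq
    · rintro _ ⟨X, hX, rfl⟩
      rw [SetLike.mem_coe, ← (hD 0 h0W).2] at hX
      obtain ⟨a, rfl⟩ := hX
      have h1 := (fderiv_mem_direction hh hmem a a).1
      rw [← mfderiv_eq_fderiv] at h1
      convert h1 using 1
      exact (mfderiv_comp_apply 0 (hf.1.contMDiffAt.mdifferentiableAt (by simp))
        (hσ0.mdifferentiableAt (by simp)) a).symm
    · rw [hL]
      exact (Submodule.equivMapOfInjective _ (hf.injective_diff _) _).finrank_eq.symm.trans
        (hsm _ hx).1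
  rw [← (hD 0 h0W).2] at hv
  obtain ⟨a, rfl⟩ := hv
  obtain ⟨w, hw⟩ := fderiv_fderiv_comp_chartExpr (σ 0) (mem_extChartAt_source (σ 0))
    (hf.1.contMDiffAt (x := σ 0)) hσ0 a a
  have h2 := (fderiv_mem_direction hh hmem a a).2
  rw [← hDL] at h2
  obtain ⟨Y, -, hY⟩ := h2
  rw [secondFF_apply]
  -- The second derivative of `f ∘ σ` is tangent, being in the direction of `L`, and so is the
  -- correction `w`; hence nothing is left in the normal space.
  have h3 : fderiv ℝ (fderiv ℝ (chartExpr f (σ 0))) (extChartAt (𝓡 n) (σ 0) (σ 0))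
      (chartVec (σ 0) (mfderiv 𝓘(ℝ, Euc d) (𝓡 n) σ 0 a))
      (chartVec (σ 0) (mfderiv 𝓘(ℝ, Euc d) (𝓡 n) σ 0 a)) = diff (n := n) f (σ 0) (Y - w) := by
    rw [map_sub]
    exact eq_sub_of_add_eq (hw.symm.trans hY.symm)
  erw [h3]
  rw [Submodule.starProjection_apply_eq_zero_iff]
  exact Submodule.le_orthogonal_orthogonal _ ⟨_, rfl⟩

end Rulings

/-! ### Conclusion for positive and nonnegative Ricci curvature. -/

theorem relNullity_le_distD {n N : ℕ} {M : Type*} [TopologicalSpace M] [ChartedSpace (Euc n) M]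
    (f : M → Euc N) (x : M) : relNullity f x ≤ distD (n := n) f x := by
  intro v hv
  simp only [distD, nullity, Submodule.mem_iInf]
  intro X
  simp [mem_relNullity_iff.1 hv X]

end

theorem corollary2 {n N p s : ℕ} {M : Type*} [TopologicalSpace M] [T2Space M]
    [SecondCountableTopology M] [ConnectedSpace M] [ChartedSpace (Euc n) M]
    [IsManifold (𝓡 n) ∞ M] (g : RiemMetric n M) (f : M → Euc N)
    (hf : IsIsometricImmersion g f) (hsub : LocallySubstantial f)
    (hp : ∀ x : M, Module.finrank ℝ (firstNormal n f x) = p) (hpN : n + p < N)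
    (hs : ∀ x : M, Module.finrank ℝ (spaceS n f x) = s)
    (hs0 : 0 < s) (hsn : s < n) (hs6 : s ≤ 6) :
    (RicciPos g →
      s < p ∧ ¬ CaseI n f p s ∧ ∀ U : Set M, IsOpen U → U.Nonempty → ¬ CaseIIIa n f p s U) ∧
    (RicciNonneg g →
      ∀ U : Set M, IsOpen U → CaseIIIa n f p s U → ∀ x ∈ U, distD (n := n) f x = relNullity f x) := by
  refine ⟨fun hpos => ?_, fun hnn U _ hU x hx => ?_⟩
  · have hlt : s < p := by
      obtain ⟨x⟩ : Nonempty M := inferInstance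
      have hle := Submodule.finrank_mono (spaceS_le_firstNormal (n := n) (f := f) x)
      rw [hs, hp] at hle
      refine lt_of_le_of_ne hle fun hsp => ?_
      have hS : spaceS n f x = firstNormal n f x :=
        Submodule.eq_of_le_of_finrank_eq (spaceS_le_firstNormal x) (by rw [hs, hp, hsp])
      obtain ⟨X, hX0, hX⟩ := exists_isotropic_of_spaceS_eq hf.1 x hS (by rwa [hs])
      exact absurd (hpos x X hX0) (hf.ricci_nonpos hX).1.not_gt
    refine ⟨hlt, fun h => hlt.ne h.1, fun U _ ⟨x, hx⟩ hU => ?_⟩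
    obtain ⟨-, -, ⟨d, hd, hr⟩, -⟩ := hU
    -- The rulings are nontrivial: `n ≤ d + s` and `s < n` exclude `d = 0`.
    have hne : distD (n := n) f x ≠ ⊥ := by
      intro h
      have h1 := (hr.1 x hx).1
      rw [h, finrank_bot] at h1
      omega
    obtain ⟨v, hv, hv0⟩ := Submodule.exists_mem_ne_zero_of_ne_bot hne
    exact absurd (hpos x v hv0) (hf.ricci_nonpos (hr.secondFF_eq_zero hf hx hv)).1.not_gt
  · obtain ⟨-, -, ⟨d, -, hr⟩, -⟩ := hU
    refine le_antisymm (fun v hv => ?_) (relNullity_le_distD f x)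
    have h := hf.ricci_nonpos (hr.secondFF_eq_zero hf hx hv)
    exact h.2 (le_antisymm h.1 (hnn x v))
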